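/- Let $\mathbb{K}$ be an algebraically closed field of characteristic $0$ (for example $\mathbb{K}=\mathbb{C}$), let $V$ be a $\mathbb{K}$-vector space of finite dimension $n>1$, and let $S^2(V)\subset V\otimes V$ be the space of symmetric elements (symmetric forms, in a basis of $V$: symmetric $n\times n$ matrices $Q$). Let $\rho$ be the representation of $\mathrm{sl}(V)$ on $S^2(V)$ corresponding to the congruence action $(P,Q)\mapsto PQP^T$, i.e. $\rho(X)Q=XQ+QX^T$, and for $a\in S^2(V)$ let $R_a:\mathrm{sl}(V)\to S^2(V)$, $R_a(X)=\rho(X)a$. By the Jordan–Kronecker normal form theorem, for every two linear maps $A,B:U\to W$ between finite-dimensional spaces there are bases of $U$ and $W$ in which the matrix of the pencil $A+\lambda B$ is block-diagonal with blocks of the following kinds: Jordan blocks $J_k(\lambda_0)+\lambda I_k$ (eigenvalue $\lambda_0\in\mathbb{K}$) and $I_k+\lambda J_k(0)$ (eigenvalue $\infty$), where $J_k(\lambda_0)$ is the upper triangular $k\times k$ Jordan block, $k\ge 1$; horizontal Kronecker blocks of size $(h-1)\times h$, $h\ge1$, with $\lambda$ on the main diagonal, $1$ directly to the right of it, and $0$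 elsewhere; vertical Kronecker blocks of size $v\times(v-1)$, $v\ge1$, which are transposes of horizontal ones. The zero block is regarded as composed of blocks of sizes $0\times1$ and $1\times0$. The widths $h$ of the horizontal blocks are the horizontal indices, and the heights $v$ of the vertical blocks are the vertical indices. The Jordan–Kronecker invariants of $\rho$ are the number of distinct eigenvalues of the Jordan blocks, the sizes of the Jordan blocks for each eigenvalue, and the horizontal and vertical indices, of the pencil $R_a+\lambda R_b$ for a generic pair $(a,b)\in S^2(V)\times S^2(V)$ (that is, for all pairs in a nonempty Zariski open subset). Theorem. The Jordan–Kronecker invariants of $\rho$ are - $\frac{n(n-1)}{2}$ horizontal indices, all equal to $2$; - one vertical index, equal to $n$. There are no Jordan blocks. -/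

import Mathlib

open scoped TensorProduct Matrix

attribute [local instance] LieRing.ofAssociativeRing

noncomputable section

namespace JordanKronecker

/-! ### Canonical form of a pair of linear maps -/

/-- The indecomposable blocks of the Jordan–Kronecker normal form of a pencil `A + λ B`. The
parameter `k` is shifted so that every value of it is allowed:
* `jordan μ k`: Jordan block of size `k + 1` with the finite eigenvalue `μ`;
* `jordanInf k`: Jordan block of size `k + 1` with eigenvalue `∞`;
* `horizontal k`: horizontal Kronecker block of size `k × (k + 1)`;
* `vertical k`: vertical Kronecker block of size `(k + 1) × k`.
The blocks `horizontal 0` and `vertical 0` (sizes `0 × 1` and `1 × 0`) make up the zero block. -/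
inductive Block (K : Type*) where
  | jordan (μ : K) (k : ℕ)
  | jordanInf (k : ℕ)
  | horizontal (k : ℕ)
  | vertical (k : ℕ)

namespace Block

variable {K : Type*}

/-- Number of rows of a block. -/
def rows : Block K → ℕ
  | jordan _ k => k + 1
  | jordanInf k => k + 1
  | horizontal k => k
  | vertical k => k + 1

/-- Number of columns of a block. -/
def cols : Block K → ℕ
  | jordan _ k => k + 1
  | jordanInf k => k + 1
  | horizontal k => k + 1
  | vertical k => k

/-- The entry in position `(i, j)` (counted from `0`) of the matrix `A` of a block. -/
def entryA [Field K] : Block K → ℕ → ℕ → K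
  | jordan μ _, i, j => if i = j then μ else if i + 1 = j then 1 else 0
  | jordanInf _, i, j => if i = j then 1 else 0
  | horizontal _, i, j => if i + 1 = j then 1 else 0
  | vertical _, i, j => if i = j + 1 then 1 else 0

/-- The entry in position `(i, j)` (counted from `0`) of the matrix `B` of a block. -/
def entryB [Field K] : Block K → ℕ → ℕ → K
  | jordan _ _, i, j => if i = j then 1 else 0
  | jordanInf _, i, j => if i + 1 = j then 1 else 0
  | horizontal _, i, j => if i = j then 1 else 0
  | vertical _, i, j => if i = j then 1 else 0

/-- The matrix `A` of a block of the pencil `A + λ B`. -/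
def matA [Field K] (β : Block K) : Matrix (Fin β.rows) (Fin β.cols) K :=
  Matrix.of fun i j => β.entryA i j

/-- The matrix `B` of a block of the pencil `A + λ B`. -/
def matB [Field K] (β : Block K) : Matrix (Fin β.rows) (Fin β.cols) K :=
  Matrix.of fun i j => β.entryB i j

/-- The eigenvalue (in `K ∪ {∞}`) and the size of a Jordan block. -/
def jordanData : Block K → Option (OnePoint K × ℕ)
  | jordan μ k => some ((μ : OnePoint K), k + 1)
  | jordanInf k => some (OnePoint.infty, k + 1)
  | _ => none

/-- The horizontal index (width) of a horizontal Kronecker block. -/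
def horizontalIndex : Block K → Option ℕ
  | horizontal k => some (k + 1)
  | _ => none

/-- The vertical index (height) of a vertical Kronecker block. -/
def verticalIndex : Block K → Option ℕ
  | vertical k => some (k + 1)
  | _ => none

end Block

/-- The possible algebraic types of pencils. -/
@[ext]
structure AlgType where
  /-- one member for each distinct eigenvalue: the multiset of the sizes of its Jordan blocks -/
  jordan : Multiset (Multiset ℕ)
  /-- the horizontal indices -/
  horizontal : Multiset ℕ
  /-- the vertical indices -/
  vertical : Multiset ℕ

open Classical in
/-- The algebraic type of a pencil in normal form with the given blocks. -/
def algType {K : Type*} (s : Multiset (Block K)) : AlgType where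
  jordan :=
    let d := s.filterMap Block.jordanData
    (d.map Prod.fst).dedup.map fun e => (d.filter fun p => p.1 = e).map Prod.snd
  horizontal := s.filterMap Block.horizontalIndex
  vertical := s.filterMap Block.verticalIndex

/-- The pencil `A + λ B` of linear maps `U → W` has algebraic type `T`: there are bases of `U` and
`W` in which the matrices of `A` and `B` are simultaneously block-diagonal with Jordan and Kronecker
blocks whose sizes and eigenvalues are described by `T`. -/
def HasAlgType {K U W : Type*} [Field K] [AddCommGroup U] [Module K U] [AddCommGroup W] [Module K W]
    (A B : U →ₗ[K] W) (T : AlgType) : Prop :=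
  ∃ (ι : Type) (_ : Fintype ι) (_ : DecidableEq ι) (β : ι → Block K)
    (u : Module.Basis (Σ i, Fin (β i).cols) K U) (w : Module.Basis (Σ i, Fin (β i).rows) K W),
    LinearMap.toMatrix u w A = Matrix.blockDiagonal' (fun i => (β i).matA) ∧
    LinearMap.toMatrix u w B = Matrix.blockDiagonal' (fun i => (β i).matB) ∧
    algType (Finset.univ.val.map β) = T

/-! ### Jordan–Kronecker invariants of Lie algebra representations -/

/-- The property `P` holds for a generic point of the finite-dimensional space `W`: it holds
wherever a certain nonzero polynomial in the coordinates does not vanish, that is, on a nonempty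
Zariski open subset if `K` is infinite. (The choice of the coordinates does not matter.) -/
def Generic (K : Type*) {W : Type*} [Field K] [AddCommGroup W] [Module K W] (P : W → Prop) : Prop :=
  ∃ (m : ℕ) (b : Module.Basis (Fin m) K W) (p : MvPolynomial (Fin m) K), p ≠ 0 ∧
    ∀ x : W, MvPolynomial.eval (fun i => b.repr x i) p ≠ 0 → P x

section Representation

variable {K L M : Type*} [Field K] [LieRing L] [LieAlgebra K L] [AddCommGroup M] [Module K M]

/-- The operator `R_x : 𝔤 → M`, `R_x ξ = ρ(ξ) x`, of a representation `ρ` of `𝔤` on `M`. -/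
def opR (ρ : L →ₗ⁅K⁆ Module.End K M) (x : M) : L →ₗ[K] M :=
  (ρ : L →ₗ[K] Module.End K M).flip x

/-- The Jordan–Kronecker invariant of `ρ` is `T`: for a generic pair `(a, b)` the pencil
`R_a + λ R_b` has algebraic type `T`. -/
def HasJKInvariant (ρ : L →ₗ⁅K⁆ Module.End K M) (T : AlgType) : Prop :=
  Generic K fun ab : M × M => HasAlgType (opR ρ ab.1) (opR ρ ab.2) T

end Representation

/-! ### The congruence representation of `sl(V)` on symmetric forms -/

section Congruence

variable (K V : Type*) [Field K] [AddCommGroup V] [Module K V]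

/-- The special linear Lie algebra `sl(V)`: the endomorphisms of trace zero. -/
def sl : LieSubalgebra K (Module.End K V) where
  toSubmodule := LinearMap.ker (LinearMap.trace K V)
  lie_mem' {x y} _ _ := by simp

/-- The space `S²(V)` of symmetric elements of `V ⊗ V`, with the action of `gl(V)` inherited from
`V ⊗ V`, that is `X · (v ⊗ w) = X v ⊗ w + v ⊗ X w` on decomposable tensors. -/
def Sym2Forms : LieSubmodule K (Module.End K V) (V ⊗[K] V) where
  toSubmodule := LinearMap.eqLocus (TensorProduct.comm K V V : V ⊗[K] V →ₗ[K] V ⊗[K] V) LinearMap.id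
  lie_mem {X t} ht := by
    have key : ∀ s : V ⊗[K] V, TensorProduct.comm K V V ⁅X, s⁆ = ⁅X, TensorProduct.comm K V V s⁆ := by
      intro s
      induction s with
      | zero => simp
      | tmul v w => simp [add_comm]
      | add a b ha hb => simp [ha, hb]
    change TensorProduct.comm K V V t = t at ht
    change TensorProduct.comm K V V ⁅X, t⁆ = ⁅X, t⁆
    rw [key, ht]

/-- The representation of `sl(V)` on `S²(V)` corresponding to the congruence action. -/
def slSymCongruence : sl K V →ₗ⁅K⁆ Module.End K (Sym2Forms K V) :=
  LieModule.toEnd K (sl K V) (Sym2Forms K V)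

/-- In coordinates, the congruence representation is `ρ(X) Q = X Q + Q Xᵀ`, and it is the
differential of the action `P, Q ↦ P Q Pᵀ`. -/
theorem slSymCongruence_matrix {ι : Type*} [Fintype ι] [DecidableEq ι] (e : Module.Basis ι K V)
    (X : sl K V) (Q : Sym2Forms K V) :
    (Matrix.of fun i j => (e.tensorProduct e).repr (slSymCongruence K V X Q : V ⊗[K] V) (i, j)) =
      LinearMap.toMatrix e e X * (Matrix.of fun i j => (e.tensorProduct e).repr Q (i, j)) +
      (Matrix.of fun i j => (e.tensorProduct e).repr Q (i, j)) * (LinearMap.toMatrix e e X)ᵀ := by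
  obtain ⟨X, hX⟩ := X
  obtain ⟨t, ht⟩ := Q
  change (Matrix.of fun i j => (e.tensorProduct e).repr ⁅X, t⁆ (i, j)) =
    LinearMap.toMatrix e e X * (Matrix.of fun i j => (e.tensorProduct e).repr t (i, j)) +
    (Matrix.of fun i j => (e.tensorProduct e).repr t (i, j)) * (LinearMap.toMatrix e e X)ᵀ
  clear ht
  ext i j
  have hrep : ∀ (v : V) (k : ι), e.repr (X v) k = ∑ l, LinearMap.toMatrix e e X k l * e.repr v l := by
    intro v k
    rw [← LinearMap.toMatrix_mulVec_repr e e X v]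
    rfl
  induction t with
  | zero => simp [Matrix.mul_apply]
  | tmul v w =>
    simp only [Matrix.of_apply, Matrix.add_apply, Matrix.mul_apply, Matrix.transpose_apply,
      TensorProduct.LieModule.lie_tmul_right, map_add, Finsupp.add_apply,
      Module.Basis.tensorProduct_repr_tmul_apply, Module.End.lie_apply, hrep, smul_eq_mul,
      Finset.mul_sum, Finset.sum_mul]
    congr 1 <;> refine Finset.sum_congr rfl fun l _ => ?_ <;> ring
  | add a b ha hb =>
    simp only [Matrix.of_apply, Matrix.add_apply, Matrix.mul_apply, Matrix.transpose_apply,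
      lie_add, map_add, Finsupp.add_apply, mul_add, add_mul, Finset.sum_add_distrib] at ha hb ⊢
    rw [ha, hb]
    ring

end Congruence

end JordanKronecker

end

/-! For a generic pair of symmetric matrices `(A, B)`, `A` is invertible and `A⁻¹B` has distinct
eigenvalues. Over an algebraically closed field such a pair is congruent to `(1, D)` with `D =
diag(d_k)` and distinct `d_k` (`exists_simultaneous_congruence`). A congruence is a change of basis
of `V`, so only this diagonal pair has to be analysed.

There the pencil is `X ↦ X(1 + λD) + (1 + λD)Xᵀ`, and it splits. For `i < j` the entries `x_ij`,
`x_ji` contribute only to the `(i, j)` coordinate, through `x_ij + x_ji` and `d_j x_ij + d_i x_ji`.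
These two functionals are independent since `d_i ≠ d_j`, which gives a `1 × 2` horizontal block. On
traceless diagonal matrices the two maps are, up to the factor 2, the inclusion into all diagonal
matrices and multiplication by `D`. With the Lagrange weights `f_k` of the nodes `d_k`, the vectors
`(f_k d_k^r)_k` are traceless for `r < n - 1` (`exists_weights`) and `D` raises `r` by one, so they
form a single `n × (n-1)` vertical block. `hasAlgType_of_diagonal` assembles these blocks.

Genericity (`generic_separable`) is the nonvanishing of a determinant times a resultant, tested at
one explicit pair. -/

namespace JordanKronecker

/-! ### Recognising the normal form from explicit families of vectors. -/

/-- If the given families are mapped by `A` and `B` as in the blocks `β`, then the matrices in the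
corresponding bases are block diagonal. -/
theorem toMatrix_eq_blockDiagonal' {K U W ι : Type*} [Field K] [AddCommGroup U] [Module K U]
    [AddCommGroup W] [Module K W] [Fintype ι] [DecidableEq ι] {c r : ι → ℕ}
    (u : Module.Basis (Σ i, Fin (c i)) K U) (w : Module.Basis (Σ i, Fin (r i)) K W)
    (A : U →ₗ[K] W) (M : ∀ i, Matrix (Fin (r i)) (Fin (c i)) K)
    (h : ∀ i j, A (u ⟨i, j⟩) = ∑ k, M i k j • w ⟨i, k⟩) :
    LinearMap.toMatrix u w A = Matrix.blockDiagonal' M := by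
  ext ⟨i, k⟩ ⟨i', j⟩
  rw [LinearMap.toMatrix_apply, h, map_sum, Finsupp.finsetSum_apply, Matrix.blockDiagonal'_apply]
  simp only [map_smul, Module.Basis.repr_self, Finsupp.smul_apply, Finsupp.single_apply,
    smul_eq_mul, Sigma.mk.injEq, mul_ite, mul_one, mul_zero]
  split_ifs with hi
  · subst hi
    simp
  · exact Finset.sum_eq_zero fun x _ => if_neg fun hx => hi (congrArg Sigma.fst hx).symm

/-- A criterion for a pencil to consist of horizontal Kronecker blocks of size `1 × 2` and one
vertical Kronecker block. -/
theorem hasAlgType_of_families {K U W : Type*} [Field K] [AddCommGroup U] [Module K U]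
    [AddCommGroup W] [Module K W] [FiniteDimensional K U] [FiniteDimensional K W]
    {P : Type} [Fintype P] [DecidableEq P] {m : ℕ}
    (A B : U →ₗ[K] W) (x y : P → U) (g : Fin m → U) (s : P → W) (h : Fin (m + 1) → W)
    (hAx : ∀ p, A (x p) = 0) (hBx : ∀ p, B (x p) = s p)
    (hAy : ∀ p, A (y p) = s p) (hBy : ∀ p, B (y p) = 0)
    (hAg : ∀ j, A (g j) = h j.succ) (hBg : ∀ j, B (g j) = h j.castSucc)
    (hli : LinearIndependent K (Sum.elim s h))
    (hU : Module.finrank K U = 2 * Fintype.card P + m)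
    (hW : Module.finrank K W = Fintype.card P + (m + 1)) :
    HasAlgType A B
      { jordan := 0
        horizontal := Multiset.replicate (Fintype.card P) 2
        vertical := {m + 1} } := by
  classical
  let β : Option P → Block K := fun i => i.elim (Block.vertical m) fun _ => Block.horizontal 1
  let w : (Σ i, Fin (β i).rows) → W := fun q =>
    match q with
    | ⟨none, j⟩ => h j
    | ⟨some p, _⟩ => s p
  let u : (Σ i, Fin (β i).cols) → U := fun q =>
    match q with
    | ⟨none, j⟩ => g j
    | ⟨some p, j⟩ => (![x p, y p] : Fin 2 → U) j
  have hsw : ∀ c : (Σ i, Fin (β i).rows) → K, ∑ q, c q • w q =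
      ∑ j : Fin (m + 1), c ⟨none, j⟩ • h j + ∑ p, c ⟨some p, (0 : Fin 1)⟩ • s p := by
    intro c
    rw [Fintype.sum_sigma, Fintype.sum_option]
    congr 1
    refine Finset.sum_congr rfl fun p _ => ?_
    exact Fin.sum_univ_one (fun j : Fin 1 => c ⟨some p, j⟩ • w ⟨some p, j⟩)
  have hsu : ∀ c : (Σ i, Fin (β i).cols) → K, ∑ q, c q • u q =
      ∑ j : Fin m, c ⟨none, j⟩ • g j +
        ∑ p, (c ⟨some p, (0 : Fin 2)⟩ • x p + c ⟨some p, (1 : Fin 2)⟩ • y p) := by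
    intro c
    rw [Fintype.sum_sigma, Fintype.sum_option]
    congr 1
    refine Finset.sum_congr rfl fun p _ => ?_
    exact Fin.sum_univ_two (fun j : Fin 2 => c ⟨some p, j⟩ • u ⟨some p, j⟩)
  have key : ∀ (a : Fin (m + 1) → K) (b : P → K), ∑ j, a j • h j + ∑ p, b p • s p = 0 →
      (∀ j, a j = 0) ∧ ∀ p, b p = 0 := by
    intro a b hab
    have := Fintype.linearIndependent_iff.1 hli (Sum.elim b a)
      (by rw [Fintype.sum_sum_type, add_comm]; simpa using hab)
    exact ⟨fun j => this (Sum.inr j), fun p => this (Sum.inl p)⟩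
  have hw : LinearIndependent K w := by
    refine Fintype.linearIndependent_iff.2 fun c hc => ?_
    rw [hsw] at hc
    obtain ⟨h1, h2⟩ := key _ _ hc
    rintro ⟨_ | p, j⟩
    · exact h1 j
    · have : j = (0 : Fin 1) := Subsingleton.elim (α := Fin 1) _ _
      rw [this]
      exact h2 p
  -- Independence in the source is inherited from the target: applying `A` to a relation kills the
  -- coefficients of `y` and `g`, applying `B` those of `x`.
  have hu : LinearIndependent K u := by
    refine Fintype.linearIndependent_iff.2 fun c hc => ?_
    rw [hsu] at hc
    have hA := congrArg A hc
    have hB := congrArg B hc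
    simp only [map_add, map_sum, map_smul, hAx, hAy, hAg, hBx, hBy, hBg, smul_zero, zero_add,
      add_zero, map_zero] at hA hB
    -- The images `A (g j)` miss `h 0` and the images `B (g j)` miss the last `h`, hence the padding
    -- by zero at opposite ends.
    have eA := key (Fin.cons 0 fun j => c ⟨none, j⟩) (fun p => c ⟨some p, (1 : Fin 2)⟩)
      (by simpa [Fin.sum_univ_succ] using hA)
    have eB := key (Fin.snoc (fun j => c ⟨none, j⟩) 0) (fun p => c ⟨some p, (0 : Fin 2)⟩)
      (by simpa [Fin.sum_univ_castSucc] using hB)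
    rintro ⟨_ | p, j⟩
    · exact eA.1 (Fin.succ j)
    · change Fin 2 at j
      fin_cases j
      · exact eB.2 p
      · exact eA.2 p
  have cw : Fintype.card (Σ i, Fin (β i).rows) = Module.finrank K W := by
    rw [hW, Fintype.card_sigma, Fintype.sum_option]
    change Fintype.card (Fin (m + 1)) + ∑ _ : P, Fintype.card (Fin 1) = _
    simp [add_comm]
  have cu : Fintype.card (Σ i, Fin (β i).cols) = Module.finrank K U := by
    rw [hU, Fintype.card_sigma, Fintype.sum_option]
    change Fintype.card (Fin m) + ∑ _ : P, Fintype.card (Fin 2) = _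
    simp [add_comm, mul_comm]
  have : Nonempty (Σ i, Fin (β i).rows) := ⟨⟨none, (0 : Fin (m + 1))⟩⟩
  let bw := basisOfLinearIndependentOfCardEqFinrank hw cw
  -- Unlike the row index, the column index may be empty (`m = 0` and `P` empty), so a construction
  -- without a nonemptiness assumption is used.
  let bu : Module.Basis (Σ i, Fin (β i).cols) K U :=
    Module.Basis.mk hu (hu.span_eq_top_of_card_eq_finrank' cu).ge
  refine ⟨Option P, inferInstance, inferInstance, β, bu, bw, ?_, ?_, ?_⟩
  · refine toMatrix_eq_blockDiagonal' bu bw A _ fun i j => ?_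
    simp only [bu, bw, Module.Basis.mk_apply, coe_basisOfLinearIndependentOfCardEqFinrank]
    rcases i with _ | p
    · change Fin m at j
      refine (hAg j).trans (Eq.symm ?_)
      refine (Finset.sum_eq_single (M := W) (s := Finset.univ)
        (f := fun k : Fin (m + 1) => (if (k : ℕ) = (j : ℕ) + 1 then (1 : K) else 0) • h k)
        (Fin.succ j) (fun k _ hk => ?_) (by simp)).trans (by simp)
      exact (congrArg (· • h k) (if_neg fun e => hk (Fin.ext e))).trans (zero_smul K _)
    · refine Eq.trans ?_ (Fin.sum_univ_one (fun k : Fin 1 =>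
        (if (k : ℕ) + 1 = (j : ℕ) then (1 : K) else 0) • s p)).symm
      change Fin 2 at j
      fin_cases j
      · simpa [u] using hAx p
      · simpa [u] using hAy p
  · refine toMatrix_eq_blockDiagonal' bu bw B _ fun i j => ?_
    simp only [bu, bw, Module.Basis.mk_apply, coe_basisOfLinearIndependentOfCardEqFinrank]
    rcases i with _ | p
    · change Fin m at j
      refine (hBg j).trans (Eq.symm ?_)
      refine (Finset.sum_eq_single (M := W) (s := Finset.univ)
        (f := fun k : Fin (m + 1) => (if (k : ℕ) = (j : ℕ) then (1 : K) else 0) • h k)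
        (Fin.castSucc j) (fun k _ hk => ?_) (by simp)).trans (by simp)
      exact (congrArg (· • h k) (if_neg fun e => hk (Fin.ext e))).trans (zero_smul K _)
    · refine Eq.trans ?_ (Fin.sum_univ_one (fun k : Fin 1 =>
        (if (k : ℕ) = (j : ℕ) then (1 : K) else 0) • s p)).symm
      change Fin 2 at j
      fin_cases j
      · simpa [u] using hBx p
      · simpa [u] using hBy p
  · have hβ : Finset.univ.val.map β =
        Block.vertical m ::ₘ Multiset.replicate (Fintype.card P) (Block.horizontal 1) := by
      rw [univ_option]
      simp [β, Multiset.map_map, Function.comp_def, Finset.insertNone]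
    have e1 : ∀ N : ℕ, (Multiset.replicate N (Block.horizontal (K := K) 1)).filterMap
        Block.jordanData = 0 := by
      intro N; induction N with
      | zero => rfl
      | succ N ih => rw [Multiset.replicate_succ, Multiset.filterMap_cons_none _ _ rfl, ih]
    have e2 : ∀ N : ℕ, (Multiset.replicate N (Block.horizontal (K := K) 1)).filterMap
        Block.verticalIndex = 0 := by
      intro N; induction N with
      | zero => rfl
      | succ N ih => rw [Multiset.replicate_succ, Multiset.filterMap_cons_none _ _ rfl, ih]
    have e3 : ∀ N : ℕ, (Multiset.replicate N (Block.horizontal (K := K) 1)).filterMap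
        Block.horizontalIndex = Multiset.replicate N 2 := by
      intro N; induction N with
      | zero => rfl
      | succ N ih =>
        rw [Multiset.replicate_succ, Multiset.filterMap_cons_some Block.horizontalIndex _ _ rfl, ih,
          Multiset.replicate_succ]
    rw [hβ]
    ext1
    · simp only [algType]
      rw [Multiset.filterMap_cons_none _ _ rfl, e1]
      rfl
    · simp only [algType]
      rw [Multiset.filterMap_cons_none _ _ rfl, e3]
    · simp only [algType]
      rw [Multiset.filterMap_cons_some Block.verticalIndex _ _ rfl, e2]
      rfl

/-! ### Coordinates on symmetric tensors and the action on a diagonal form. -/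

theorem repr_comm {K V ι : Type*} [Field K] [AddCommGroup V] [Module K V]
    (e : Module.Basis ι K V) (t : V ⊗[K] V) (i j : ι) :
    (e.tensorProduct e).repr (TensorProduct.comm K V V t) (i, j) =
      (e.tensorProduct e).repr t (j, i) := by
  induction t with
  | zero => simp
  | tmul v w => simp [mul_comm]
  | add a b ha hb => simp [ha, hb]

section

variable {K V : Type*} [Field K] [AddCommGroup V] [Module K V]

theorem mem_Sym2Forms {t : V ⊗[K] V} : t ∈ Sym2Forms K V ↔ TensorProduct.comm K V V t = t :=
  Iff.rfl

theorem repr_symm {ι : Type*} (e : Module.Basis ι K V) (t : Sym2Forms K V) (i j : ι) :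
    (e.tensorProduct e).repr (t : V ⊗[K] V) (i, j) = (e.tensorProduct e).repr t (j, i) := by
  rw [← repr_comm, mem_Sym2Forms.1 t.2]

/-- The symmetric element `v ⊗ w + w ⊗ v`. -/
def symTmul (v w : V) : Sym2Forms K V :=
  ⟨v ⊗ₜ[K] w + w ⊗ₜ[K] v, by rw [mem_Sym2Forms]; simp [add_comm]⟩

theorem symTmul_comm (v w : V) : symTmul (K := K) v w = symTmul w v :=
  Subtype.ext (add_comm _ _)

theorem repr_symTmul {ι : Type*} [DecidableEq ι] (e : Module.Basis ι K V) (i j k l : ι) :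
    (e.tensorProduct e).repr (symTmul (K := K) (e i) (e j) : V ⊗[K] V) (k, l) =
      (if i = k then 1 else 0) * (if j = l then 1 else 0) +
        (if j = k then 1 else 0) * (if i = l then 1 else 0) := by
  simp only [symTmul, map_add, Finsupp.add_apply, Module.Basis.tensorProduct_repr_tmul_apply,
    Module.Basis.repr_self, Finsupp.single_apply, smul_eq_mul]
  ring

/-- The traceless endomorphism with the given matrix. -/
noncomputable def slOfMatrix {ι : Type*} [Fintype ι] [DecidableEq ι] (e : Module.Basis ι K V)
    (M : Matrix ι ι K) (hM : M.trace = 0) : sl K V :=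
  ⟨Matrix.toLin e e M, by
    change LinearMap.trace K V _ = 0
    rw [Matrix.trace_toLin_eq, hM]⟩

/-- The action of matrices on the symmetric element `∑ k, c k • e k ⊗ e k`. -/
noncomputable def diagonalAction {ι : Type*} [Fintype ι] (e : Module.Basis ι K V) (c : ι → K) :
    Matrix ι ι K →ₗ[K] Sym2Forms K V where
  toFun M := ∑ k, ∑ i, (c k * M i k) • symTmul (e i) (e k)
  map_add' M N := by simp [mul_add, add_smul, Finset.sum_add_distrib]
  map_smul' r M := by
    simp only [Matrix.smul_apply, smul_eq_mul, RingHom.id_apply, Finset.smul_sum, smul_smul]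
    refine Finset.sum_congr rfl fun k _ => Finset.sum_congr rfl fun i _ => ?_
    congr 1
    ring

theorem diagonalAction_single {ι : Type*} [Fintype ι] [DecidableEq ι] (e : Module.Basis ι K V)
    (c : ι → K) (i j : ι) (r : K) :
    diagonalAction e c (Matrix.single i j r) = (c j * r) • symTmul (e i) (e j) := by
  change ∑ k, ∑ l, (c k * Matrix.single i j r l k) • symTmul (e l) (e k) = _
  rw [Finset.sum_eq_single j, Finset.sum_eq_single i]
  · simp
  · intro l _ hl
    simp [hl.symm]
  · simp
  · intro k _ hk
    simp [hk.symm]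
  · simp

theorem diagonalAction_diagonal {ι : Type*} [Fintype ι] [DecidableEq ι] (e : Module.Basis ι K V)
    (c f : ι → K) :
    diagonalAction e c (Matrix.diagonal f) = ∑ k, (c k * f k) • symTmul (e k) (e k) := by
  change ∑ k, ∑ l, (c k * Matrix.diagonal f l k) • symTmul (e l) (e k) = _
  refine Finset.sum_congr rfl fun k _ => ?_
  rw [Finset.sum_eq_single k]
  · simp
  · intro l _ hl
    simp [Matrix.diagonal_apply_ne _ hl]
  · simp

/-- Passing to `diagonalAction`, which is linear on all matrices, allows a traceless matrix to be
split into matrix units that need not be traceless themselves. -/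
theorem opR_slOfMatrix {ι : Type*} [Fintype ι] [DecidableEq ι] (e : Module.Basis ι K V)
    (M : Matrix ι ι K) (hM : M.trace = 0) (c : ι → K) (t : Sym2Forms K V)
    (ht : (t : V ⊗[K] V) = ∑ k, c k • (e k ⊗ₜ[K] e k)) :
    opR (slSymCongruence K V) t (slOfMatrix e M hM) = diagonalAction e c M := by
  apply Subtype.ext
  change ⁅Matrix.toLin e e M, (t : V ⊗[K] V)⁆ =
    ((∑ k, ∑ i, (c k * M i k) • symTmul (e i) (e k) : Sym2Forms K V) : V ⊗[K] V)
  rw [ht]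
  simp only [lie_sum, lie_smul, TensorProduct.LieModule.lie_tmul_right, Module.End.lie_apply,
    Matrix.toLin_self, AddSubmonoidClass.coe_finsetSum, SetLike.val_smul, symTmul,
    TensorProduct.sum_tmul, TensorProduct.tmul_sum, TensorProduct.smul_tmul',
    TensorProduct.tmul_smul, ← Finset.sum_add_distrib, Finset.smul_sum, smul_add, smul_smul,
    mul_comm (c _)]

end

/-! ### Dimension counts. -/

theorem card_ordered_pairs (n : ℕ) :
    Fintype.card {p : Fin n × Fin n // p.1 < p.2} = n * (n - 1) / 2 := by
  rw [Fintype.card_subtype, Finset.card_filter, ← Finset.univ_product_univ, Finset.sum_product]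
  simp_rw [← Finset.card_filter]
  have : ∀ i : Fin n, (Finset.univ.filter fun j => i < j).card = n - 1 - i := by
    intro i
    rw [← Fin.card_Ioi i]
    congr 1
    ext j
    simp
  simp_rw [this]
  rw [Fin.sum_univ_eq_sum_range (fun i => n - 1 - i) n, Finset.sum_range_reflect (fun i => i) n,
    Finset.sum_range_id]

section

variable {K V : Type*} [Field K] [AddCommGroup V] [Module K V]

theorem finrank_sl [FiniteDimensional K V] (h : 0 < Module.finrank K V) :
    Module.finrank K (sl K V) + 1 = Module.finrank K V * Module.finrank K V := by
  have hne : (LinearMap.trace K V : Module.Dual K (Module.End K V)) ≠ 0 := by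
    intro h0
    let e := Module.finBasis K V
    have := LinearMap.congr_fun h0 (Matrix.toLin e e (Matrix.single ⟨0, h⟩ ⟨0, h⟩ 1))
    rw [Matrix.trace_toLin_eq] at this
    simp at this
  rw [← Module.finrank_linearMap K K V V]
  exact Module.Dual.finrank_ker_add_one_of_ne_zero hne

/-- A symmetric tensor is determined by its coordinates on and above the diagonal. The upper bound
is enough, since an independent family of this size is exhibited later. -/
theorem finrank_Sym2Forms_le {n : ℕ} (e : Module.Basis (Fin n) K V) :
    Module.finrank K (Sym2Forms K V) ≤
      Fintype.card {p : Fin n × Fin n // p.1 < p.2} + n := by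
  let f : Sym2Forms K V →ₗ[K] ({p : Fin n × Fin n // p.1 < p.2} ⊕ Fin n → K) :=
    LinearMap.pi fun q => (e.tensorProduct e).coord (q.elim (fun p => p.1) fun k => (k, k)) ∘ₗ
      (Sym2Forms K V).toSubmodule.subtype
  have hf : Function.Injective f := by
    rw [← LinearMap.ker_eq_bot, LinearMap.ker_eq_bot']
    intro t ht
    apply Subtype.ext
    apply (e.tensorProduct e).ext_elem
    rintro ⟨i, j⟩
    rw [ZeroMemClass.coe_zero, map_zero, Finsupp.zero_apply]
    rcases lt_trichotomy i j with h | h | h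
    · exact congrFun ht (Sum.inl ⟨(i, j), h⟩)
    · subst h
      exact congrFun ht (Sum.inr i)
    · rw [repr_symm]
      exact congrFun ht (Sum.inl ⟨(j, i), h⟩)
  refine (LinearMap.finrank_le_finrank_of_injective hf).trans ?_
  simp

end

/-! ### The pencil of a simultaneously diagonal pair. -/

/-- The Lagrange weights are orthogonal to the powers of degree less than the number of nodes
minus one. -/
theorem exists_weights {K : Type*} [Field K] {m : ℕ} {d : Fin (m + 1) → K}
    (hd : Function.Injective d) :
    ∃ f : Fin (m + 1) → K, (∀ k, f k ≠ 0) ∧ ∀ r < m, ∑ k, f k * d k ^ r = 0 := by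
  refine ⟨fun k => (∏ j ∈ Finset.univ.erase k, (d k - d j))⁻¹, fun k => ?_, fun r hr => ?_⟩
  · refine inv_ne_zero (Finset.prod_ne_zero_iff.2 fun j hj => sub_ne_zero.2 fun h => ?_)
    exact (Finset.mem_erase.1 hj).1 (hd h).symm
  -- Interpolating `X ^ r` at the `m + 1` nodes returns `X ^ r`. The weighted sum is its coefficient
  -- at `X ^ m`, which vanishes for `r < m`.
  · have := Lagrange.coeff_eq_sum (s := Finset.univ) (v := d) hd.injOn
      (P := (Polynomial.X ^ r : Polynomial K)) (by
        rw [Polynomial.degree_X_pow, Finset.card_univ, Fintype.card_fin]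
        exact_mod_cast hr.trans (Nat.lt_succ_self m))
    rw [Finset.card_univ, Fintype.card_fin, Nat.add_sub_cancel, Polynomial.coeff_X_pow,
      if_neg hr.ne'] at this
    rw [this]
    refine Finset.sum_congr rfl fun k _ => ?_
    rw [Polynomial.eval_pow, Polynomial.eval_X, div_eq_mul_inv, mul_comm]

/-- The type of the pencil `R_a + λ R_b` for simultaneously diagonal forms `a` and `b`. -/
theorem hasAlgType_of_diagonal {K V : Type*} [Field K] [NeZero (2 : K)] [AddCommGroup V]
    [Module K V] {m : ℕ} (e : Module.Basis (Fin (m + 1)) K V) (d : Fin (m + 1) → K)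
    (hd : Function.Injective d) (a b : Sym2Forms K V)
    (ha : (a : V ⊗[K] V) = ∑ k, e k ⊗ₜ[K] e k)
    (hb : (b : V ⊗[K] V) = ∑ k, d k • (e k ⊗ₜ[K] e k)) :
    HasAlgType (opR (slSymCongruence K V) a) (opR (slSymCongruence K V) b)
      { jordan := 0
        horizontal := Multiset.replicate ((m + 1) * m / 2) 2
        vertical := {m + 1} } := by
  have : FiniteDimensional K V := e.finiteDimensional_of_finite
  have hV : Module.finrank K V = m + 1 := by simp [Module.finrank_eq_card_basis e]
  obtain ⟨f, hf, hfd⟩ := exists_weights hd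
  have hA : ∀ M hM, opR (slSymCongruence K V) a (slOfMatrix e M hM) =
      diagonalAction e (fun _ => 1) M := fun M hM =>
    opR_slOfMatrix e M hM _ a (by simpa using ha)
  have hB : ∀ M hM, opR (slSymCongruence K V) b (slOfMatrix e M hM) = diagonalAction e d M :=
    fun M hM => opR_slOfMatrix e M hM _ b hb
  have hcard := card_ordered_pairs (m + 1)
  rw [Nat.add_sub_cancel] at hcard
  have heven : 2 * ((m + 1) * m / 2) = (m + 1) * m :=
    Nat.mul_div_cancel' (by rw [mul_comm]; exact (Nat.even_mul_succ_self m).two_dvd)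
  let P := {p : Fin (m + 1) × Fin (m + 1) // p.1 < p.2}
  let s : P → Sym2Forms K V := fun p => symTmul (e p.1.1) (e p.1.2)
  -- The exponents decrease with `j` because `b` raises the exponent, while in a vertical block `B`
  -- hits the vector just before the one hit by `A`.
  let h : Fin (m + 1) → Sym2Forms K V := fun j =>
    ∑ k, (f k * d k ^ (Fin.rev j : ℕ)) • symTmul (e k) (e k)
  have hne : ∀ p : P, d p.1.2 - d p.1.1 ≠ 0 := fun p => sub_ne_zero.2 fun h => p.2.ne' (hd h)
  have hli : LinearIndependent K (Sum.elim s h) := by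
    refine Fintype.linearIndependent_iff.2 fun c hc => ?_
    rw [Fintype.sum_sum_type] at hc
    simp only [Sum.elim_inl, Sum.elim_inr] at hc
    have hc' : ∀ k l, ∑ p : P, c (Sum.inl p) *
          (e.tensorProduct e).repr (s p : V ⊗[K] V) (k, l) +
        ∑ j, c (Sum.inr j) * ∑ i, (f i * d i ^ (Fin.rev j : ℕ)) *
          (e.tensorProduct e).repr (symTmul (K := K) (e i) (e i) : V ⊗[K] V) (k, l) = 0 := by
      intro k l
      have := congrArg (fun t : Sym2Forms K V => (e.tensorProduct e).repr (t : V ⊗[K] V) (k, l)) hc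
      simpa [h, Finsupp.finsetSum_apply] using this
    -- The coordinate `(k, l)` with `k < l` is nonzero on exactly one member of the family.
    have h1 : ∀ p, c (Sum.inl p) = 0 := by
      rintro ⟨⟨k, l⟩, hkl⟩
      have := hc' k l
      rw [Finset.sum_eq_single ⟨(k, l), hkl⟩, Finset.sum_eq_zero (s := Finset.univ (α := Fin (m + 1))),
        add_zero] at this
      · rw [repr_symTmul] at this
        simpa [hkl.ne'] using this
      · intro j _
        rw [Finset.sum_eq_zero, mul_zero]
        intro i _
        rw [repr_symTmul]
        by_cases hik : i = k
        · have : i ≠ l := hik ▸ hkl.ne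
          simp [this]
        · simp [hik]
      · rintro ⟨⟨k', l'⟩, hkl'⟩ _ hp
        rw [repr_symTmul]
        have e1 : ¬ (k' = k ∧ l' = l) := by
          rintro ⟨rfl, rfl⟩
          exact hp rfl
        have e2 : ¬ (l' = k ∧ k' = l) := by
          rintro ⟨rfl, rfl⟩
          exact lt_asymm hkl hkl'
        simp only [← ite_and, mul_ite, mul_one, mul_zero]
        rw [if_neg (by tauto), if_neg (by tauto), add_zero, mul_zero]
      · simp
    -- The coordinate `(k, k)` of the relation is `2 * f k` times a polynomial in `d k`. Vanishing
    -- at all nodes is a Vandermonde system.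
    have h2 : (fun j => c (Sum.inr (Fin.rev j))) = 0 := by
      refine Matrix.eq_zero_of_forall_index_sum_pow_mul_eq_zero hd fun k => ?_
      have := hc' k k
      simp only [h1, zero_mul, Finset.sum_const_zero, zero_add, repr_symTmul] at this
      have h3 : ∀ j : Fin (m + 1), c (Sum.inr j) * ∑ i, (f i * d i ^ (Fin.rev j : ℕ)) *
          ((if i = k then 1 else 0) * (if i = k then 1 else 0) +
            (if i = k then 1 else 0) * (if i = k then 1 else 0)) =
          (f k * 2) * (d k ^ (Fin.rev j : ℕ) * c (Sum.inr j)) := by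
        intro j
        rw [Finset.sum_eq_single k]
        · simp only [if_true]
          ring
        · intro i _ hi
          simp [hi]
        · simp
      simp_rw [h3] at this
      rw [← Finset.mul_sum] at this
      have h4 := (mul_eq_zero.1 this).resolve_left (mul_ne_zero (hf k) two_ne_zero)
      rw [← h4]
      exact Fintype.sum_equiv Fin.revPerm _ _ fun j => by simp
    rintro (p | j)
    · exact h1 p
    · simpa using congrFun h2 (Fin.rev j)
  rw [← hcard]
  have hsl := finrank_sl (K := K) (V := V) (by omega)
  -- On the span of `E_ij` and `E_ji`, `x` spans the kernel of `R_a` and `y` that of `R_b`; the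
  -- factor `(d_j - d_i)⁻¹` makes `R_b x = R_a y = s`.
  refine hasAlgType_of_families (P := P) _ _
    (fun p => slOfMatrix e ((d p.1.2 - d p.1.1)⁻¹ •
      (Matrix.single p.1.1 p.1.2 1 - Matrix.single p.1.2 p.1.1 1)) (by simp [p.2.ne, p.2.ne']))
    (fun p => slOfMatrix e ((d p.1.2 - d p.1.1)⁻¹ •
      (Matrix.single p.1.2 p.1.1 (d p.1.2) - Matrix.single p.1.1 p.1.2 (d p.1.1)))
      (by simp [p.2.ne, p.2.ne']))
    (fun j => slOfMatrix e (Matrix.diagonal fun k => f k * d k ^ (Fin.rev j : ℕ)) (by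
      rw [Matrix.trace_diagonal]
      exact hfd _ (Fin.rev j).2))
    s h ?_ ?_ ?_ ?_ ?_ ?_ hli ?_ ?_
  · intro p
    rw [hA, map_smul, map_sub, diagonalAction_single, diagonalAction_single, symTmul_comm,
      sub_self, smul_zero]
  · intro p
    rw [hB, map_smul, map_sub, diagonalAction_single, diagonalAction_single,
      symTmul_comm (e p.1.2), ← sub_smul, smul_smul, mul_one, mul_one, inv_mul_cancel₀ (hne p),
      one_smul]
  · intro p
    rw [hA, map_smul, map_sub, diagonalAction_single, diagonalAction_single,
      symTmul_comm (e p.1.2), ← sub_smul, smul_smul, one_mul, one_mul, inv_mul_cancel₀ (hne p),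
      one_smul]
  · intro p
    rw [hB, map_smul, map_sub, diagonalAction_single, diagonalAction_single,
      symTmul_comm (e p.1.2), mul_comm, sub_self, smul_zero]
  · intro j
    rw [hA, diagonalAction_diagonal]
    simp [h]
  · intro j
    rw [hB, diagonalAction_diagonal]
    refine Finset.sum_congr rfl fun k _ => ?_
    congr 1
    have : (Fin.rev j.castSucc : ℕ) = (Fin.rev j : ℕ) + 1 := by
      simp only [Fin.val_rev, Fin.val_castSucc]
      omega
    rw [this]
    ring
  · rw [hV] at hsl
    rw [hcard, heven]
    nlinarith
  · refine le_antisymm (finrank_Sym2Forms_le e) ?_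
    simpa using hli.fintype_card_le_finrank

/-! ### Simultaneous diagonalization by congruence. -/

/-- A square matrix with separable characteristic polynomial over an algebraically closed field is
diagonalizable with distinct eigenvalues. -/
theorem exists_diagonalization {K ι : Type*} [Field K] [IsAlgClosed K] [Fintype ι] [DecidableEq ι]
    (C : Matrix ι ι K) (hC : C.charpoly.Separable) :
    ∃ (P : Matrix ι ι K) (μ : ι → K), IsUnit P ∧ Function.Injective μ ∧
      C * P = P * Matrix.diagonal μ := by
  classical
  have hcard : Fintype.card ι = Fintype.card C.charpoly.roots.toFinset := by
    rw [Fintype.card_coe, Multiset.toFinset_card_of_nodup (Polynomial.nodup_roots hC),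
      ← (IsAlgClosed.splits C.charpoly).natDegree_eq_card_roots, Matrix.charpoly_natDegree_eq_dim]
  let ε := Fintype.equivOfCardEq hcard
  let μ : ι → K := fun i => (ε i : K)
  have hμ : Function.Injective μ := Subtype.val_injective.comp ε.injective
  have hroot : ∀ i, C.charpoly.IsRoot (μ i) := fun i =>
    Polynomial.isRoot_of_mem_roots (Multiset.mem_toFinset.1 (ε i).2)
  have hv : ∀ i, ∃ v, Module.End.HasEigenvector (Matrix.toLin' C) (μ i) v := fun i =>
    ((Module.End.hasEigenvalue_iff_isRoot_charpoly (Matrix.toLin' C) (μ i)).2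
      (by rw [Matrix.charpoly_toLin']; exact hroot i)).exists_hasEigenvector
  choose v hv using hv
  have hli := Module.End.eigenvectors_linearIndependent' _ μ hμ v hv
  refine ⟨(Matrix.of v)ᵀ, μ, Matrix.linearIndependent_cols_iff_isUnit.1 hli, hμ, ?_⟩
  ext i j
  have := congrFun (hv j).apply_eq_smul i
  rw [Matrix.mul_diagonal]
  simpa [Matrix.mulVec, dotProduct, Matrix.mul_apply, mul_comm] using this

/-- A generic pair of symmetric matrices is simultaneously diagonalizable by congruence. -/
theorem exists_simultaneous_congruence {K ι : Type*} [Field K] [IsAlgClosed K] [Fintype ι]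
    [DecidableEq ι] (A B : Matrix ι ι K) (hA : Aᵀ = A) (hB : Bᵀ = B) (hdet : A.det ≠ 0)
    (hsep : (A.adjugate * B).charpoly.Separable) :
    ∃ (Q : Matrix ι ι K) (d : ι → K), IsUnit Q.det ∧ Function.Injective d ∧
      A = Q * Qᵀ ∧ B = Q * Matrix.diagonal d * Qᵀ := by
  obtain ⟨P, μ, hP, hμ, hCP⟩ := exists_diagonalization _ hsep
  have hPd : IsUnit P.det := (Matrix.isUnit_iff_isUnit_det P).1 hP
  let d : ι → K := fun i => A.det⁻¹ * μ i
  -- The adjugate is `A.det` times the inverse, so dividing by `A.det` gives the eigenvalues of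
  -- `A⁻¹B`, still distinct.
  have hd : Function.Injective d := fun i j h => hμ (mul_left_cancel₀ (inv_ne_zero hdet) h)
  have hBP : B * P = A * P * Matrix.diagonal d := by
    have h1 : A * (A.adjugate * B * P) = A.det • (B * P) := by
      rw [← Matrix.mul_assoc, ← Matrix.mul_assoc, Matrix.mul_adjugate, Matrix.smul_mul,
        Matrix.smul_mul, Matrix.one_mul]
    have h2 : Matrix.diagonal d = A.det⁻¹ • Matrix.diagonal μ := by
      rw [← Matrix.diagonal_smul]
      rfl
    rw [h2, Matrix.mul_smul, Matrix.mul_assoc, ← hCP, h1, smul_smul, inv_mul_cancel₀ hdet, one_smul]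
  let S := Pᵀ * A * P
  have hS : Sᵀ = S := by simp [S, Matrix.transpose_mul, hA, Matrix.mul_assoc]
  have hSD : Pᵀ * B * P = S * Matrix.diagonal d := by
    rw [Matrix.mul_assoc, hBP]
    simp only [S, Matrix.mul_assoc]
  -- The product is the symmetric matrix `PᵀBP`, so transposing it exchanges the factors. Commuting
  -- with a diagonal matrix with distinct entries then forces `S` to be diagonal.
  have hcomm : S * Matrix.diagonal d = Matrix.diagonal d * S := by
    have : (S * Matrix.diagonal d)ᵀ = S * Matrix.diagonal d := by
      rw [← hSD]
      simp [Matrix.transpose_mul, hB, Matrix.mul_assoc]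
    rw [← this, Matrix.transpose_mul, hS, Matrix.diagonal_transpose]
  have hSdiag : S = Matrix.diagonal S.diag := by
    ext i j
    by_cases hij : i = j
    · subst hij
      simp
    · rw [Matrix.diagonal_apply_ne _ hij]
      have := congrFun (congrFun hcomm i) j
      rw [Matrix.mul_diagonal, Matrix.diagonal_mul, mul_comm, ← sub_eq_zero, ← sub_mul] at this
      exact (mul_eq_zero.1 this).resolve_left (sub_ne_zero.2 fun h => hij (hd h).symm)
  -- Square roots of the diagonal entries normalize `S` to the identity.
  choose r hr using fun i => IsAlgClosed.exists_pow_nat_eq (S.diag i) (n := 2) two_pos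
  have hSr : S = Matrix.diagonal r * Matrix.diagonal r := by
    rw [Matrix.diagonal_mul_diagonal, hSdiag]
    congr 1
    ext i
    rw [← hr i, sq]
  have hSdet : S.det ≠ 0 := by
    simp only [S, Matrix.det_mul, Matrix.det_transpose]
    exact mul_ne_zero (mul_ne_zero hPd.ne_zero hdet) hPd.ne_zero
  have hrdet : (Matrix.diagonal r).det ≠ 0 := by
    rw [hSr, Matrix.det_mul] at hSdet
    exact left_ne_zero_of_mul hSdet
  have hinv : P * P⁻¹ = 1 := Matrix.mul_nonsing_inv P hPd
  have hinv' : (P⁻¹)ᵀ * Pᵀ = 1 := by rw [← Matrix.transpose_mul, hinv, Matrix.transpose_one]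
  have hconj : ∀ M : Matrix ι ι K, (P⁻¹)ᵀ * (Pᵀ * M * P) * P⁻¹ = M := by
    intro M
    calc (P⁻¹)ᵀ * (Pᵀ * M * P) * P⁻¹ = ((P⁻¹)ᵀ * Pᵀ) * M * (P * P⁻¹) := by
          simp only [Matrix.mul_assoc]
      _ = M := by rw [hinv, hinv', Matrix.one_mul, Matrix.mul_one]
  refine ⟨(P⁻¹)ᵀ * Matrix.diagonal r, d, ?_, hd, ?_, ?_⟩
  · rw [Matrix.det_mul, Matrix.det_transpose]
    exact (Matrix.isUnit_nonsing_inv_det P hPd).mul (isUnit_iff_ne_zero.2 hrdet)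
  · rw [Matrix.transpose_mul, Matrix.transpose_transpose, Matrix.diagonal_transpose]
    conv_lhs => rw [← hconj A, show Pᵀ * A * P = S from rfl, hSr]
    simp only [Matrix.mul_assoc]
  · have hrd : Matrix.diagonal r * Matrix.diagonal r * Matrix.diagonal d =
        Matrix.diagonal r * Matrix.diagonal d * Matrix.diagonal r := by
      simp only [Matrix.diagonal_mul_diagonal]
      congr 1
      ext i
      ring
    rw [Matrix.transpose_mul, Matrix.transpose_transpose, Matrix.diagonal_transpose]
    conv_lhs => rw [← hconj B, hSD, hSr, hrd]
    simp only [Matrix.mul_assoc]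

/-! ### Symmetric elements as matrices, and congruence as change of basis. -/

section

variable {K V ι : Type*} [Field K] [AddCommGroup V] [Module K V]

/-- The matrix of coordinates of a symmetric element. -/
noncomputable def formMatrix (e : Module.Basis ι K V) : Sym2Forms K V →ₗ[K] Matrix ι ι K where
  toFun t := Matrix.of fun i j => (e.tensorProduct e).repr (t : V ⊗[K] V) (i, j)
  map_add' s t := by ext; simp
  map_smul' c t := by ext; simp

theorem formMatrix_apply (e : Module.Basis ι K V) (t : Sym2Forms K V) (i j : ι) :
    formMatrix e t i j = (e.tensorProduct e).repr (t : V ⊗[K] V) (i, j) :=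
  rfl

theorem formMatrix_transpose (e : Module.Basis ι K V) (t : Sym2Forms K V) :
    (formMatrix e t)ᵀ = formMatrix e t := by
  ext i j
  exact repr_symm e t j i

variable [Fintype ι] [DecidableEq ι]

/-- The columns of `Q` are the coordinates of the new basis, so the factorization `Q D Qᵀ` says that
the form is diagonal in it. -/
theorem coe_eq_sum_of_formMatrix_eq (e e' : Module.Basis ι K V) (Q : Matrix ι ι K) (d : ι → K)
    (he' : ∀ k, e' k = ∑ i, Q i k • e i) (t : Sym2Forms K V)
    (ht : formMatrix e t = Q * Matrix.diagonal d * Qᵀ) :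
    (t : V ⊗[K] V) = ∑ k, d k • (e' k ⊗ₜ[K] e' k) := by
  apply (e.tensorProduct e).ext_elem
  rintro ⟨i, j⟩
  rw [← formMatrix_apply, ht, Matrix.mul_apply]
  simp only [map_sum, map_smul, Finsupp.finsetSum_apply, Finsupp.smul_apply, smul_eq_mul,
    Module.Basis.tensorProduct_repr_tmul_apply, he', Module.Basis.repr_self,
    Finsupp.single_apply, Matrix.mul_diagonal, Matrix.transpose_apply]
  refine Finset.sum_congr rfl fun k _ => ?_
  simp
  ring

/-- The diagonal symmetric element `∑ k, c k • e k ⊗ e k`. -/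
noncomputable def diagonalForm (e : Module.Basis ι K V) (c : ι → K) : Sym2Forms K V :=
  ⟨∑ k, c k • (e k ⊗ₜ[K] e k), by rw [mem_Sym2Forms]; simp⟩

theorem formMatrix_diagonalForm (e : Module.Basis ι K V) (c : ι → K) :
    formMatrix e (diagonalForm e c) = Matrix.diagonal c := by
  ext i j
  rw [formMatrix_apply]
  simp only [diagonalForm, map_sum, map_smul, Finsupp.finsetSum_apply, Finsupp.smul_apply,
    smul_eq_mul, Module.Basis.tensorProduct_repr_tmul_apply, Module.Basis.repr_self,
    Finsupp.single_apply, Matrix.diagonal_apply]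
  rw [Finset.sum_eq_single i]
  · simp
  · intro k _ hk
    simp [hk]
  · simp

end

/-! ### Genericity. -/

/-- If for some point of `W` the matrix `F x` is nondegenerate and the characteristic polynomial of
`adjugate (F x) * G x` is separable, then this holds for a generic point. -/
theorem generic_separable {K W : Type*} [Field K] [CharZero K]
    [AddCommGroup W] [Module K W] [FiniteDimensional K W] {ι : Type*} [Fintype ι] [DecidableEq ι]
    (F G : W →ₗ[K] Matrix ι ι K) (x₀ : W) (h₀ : (F x₀).det ≠ 0)
    (h₁ : ((F x₀).adjugate * G x₀).charpoly.Separable) :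
    Generic K fun x : W => (F x).det ≠ 0 ∧ ((F x).adjugate * G x).charpoly.Separable := by
  let b := Module.finBasis K W
  let N := Module.finrank K W
  let poly : (W →ₗ[K] Matrix ι ι K) → Matrix ι ι (MvPolynomial (Fin N) K) := fun H =>
    Matrix.of fun i j => ∑ q, MvPolynomial.C (H (b q) i j) * MvPolynomial.X q
  have hpoly : ∀ H x, (poly H).map (MvPolynomial.eval fun i => b.repr x i) = H x := by
    intro H x
    ext i j
    have h := congrFun (congrFun (congrArg H (b.sum_repr x)) i) j
    rw [map_sum, Matrix.sum_apply] at h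
    simpa [poly, mul_comm] using h
  -- Using the adjugate instead of the inverse keeps every coefficient polynomial in the coordinates
  -- of the point.
  let χ := ((poly F).adjugate * poly G).charpoly
  let n := Fintype.card ι
  have hχ : ∀ x, χ.map (MvPolynomial.eval fun i => b.repr x i) =
      ((F x).adjugate * G x).charpoly := by
    intro x
    rw [← Matrix.charpoly_map, Matrix.map_mul, hpoly]
    congr 2
    rw [← hpoly F x]
    exact RingHom.map_adjugate (MvPolynomial.eval fun i => b.repr x i) (poly F)
  -- The formal degrees `n` and `n - 1` are fixed so that the resultant commutes with evaluation.
  -- They remain the true degrees at each point: the characteristic polynomial is monic and the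
  -- characteristic is zero.
  have heval : ∀ x, MvPolynomial.eval (fun i => b.repr x i)
      ((poly F).det * Polynomial.resultant χ (Polynomial.derivative χ) n (n - 1)) ≠ 0 ↔
      (F x).det ≠ 0 ∧ ((F x).adjugate * G x).charpoly.Separable := by
    intro x
    have hdeg : ((F x).adjugate * G x).charpoly.natDegree = n := Matrix.charpoly_natDegree_eq_dim _
    have h := Polynomial.isUnit_resultant_iff_isCoprime
      (g := Polynomial.derivative ((F x).adjugate * G x).charpoly)
      (Matrix.charpoly_monic ((F x).adjugate * G x))
    rw [Polynomial.natDegree_derivative, hdeg, isUnit_iff_ne_zero] at h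
    rw [map_mul, mul_ne_zero_iff, RingHom.map_det, RingHom.mapMatrix_apply, hpoly,
      ← Polynomial.resultant_map_map, ← Polynomial.derivative_map, hχ, h]
    rfl
  refine ⟨N, b, _, fun h => ?_, fun x hx => (heval x).1 hx⟩
  exact (heval x₀).2 ⟨h₀, h₁⟩ (by rw [h, map_zero])

/-! ### Assembly. -/

theorem hasJKInvariant_slSymCongruence {K V : Type*} [Field K] [IsAlgClosed K] [CharZero K]
    [AddCommGroup V] [Module K V] [FiniteDimensional K V] (m : ℕ)
    (hV : Module.finrank K V = m + 1) :
    HasJKInvariant (slSymCongruence K V)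
      { jordan := 0
        horizontal := Multiset.replicate ((m + 1) * m / 2) 2
        vertical := {m + 1} } := by
  let e : Module.Basis (Fin (m + 1)) K V := Module.finBasisOfFinrankEq K V hV
  let F : Sym2Forms K V × Sym2Forms K V →ₗ[K] Matrix (Fin (m + 1)) (Fin (m + 1)) K :=
    formMatrix e ∘ₗ LinearMap.fst K _ _
  let G : Sym2Forms K V × Sym2Forms K V →ₗ[K] Matrix (Fin (m + 1)) (Fin (m + 1)) K :=
    formMatrix e ∘ₗ LinearMap.snd K _ _
  -- The test pair is the identity and `diag(0, 1, …, m)`, whose entries are distinct in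
  -- characteristic zero.
  obtain ⟨N, b, p, hp, hgen⟩ := generic_separable F G
    (diagonalForm e 1, diagonalForm e fun k => ((k : ℕ) : K))
    (by simp [F, formMatrix_diagonalForm])
    (by
      simp only [F, G, LinearMap.comp_apply, LinearMap.fst_apply, LinearMap.snd_apply,
        formMatrix_diagonalForm, Matrix.diagonal_one, Matrix.adjugate_one, Matrix.one_mul,
        Matrix.charpoly_diagonal, Pi.one_def]
      exact Polynomial.separable_prod_X_sub_C_iff.2 fun i j h => Fin.ext (Nat.cast_injective h))
  refine ⟨N, b, p, hp, fun x hx => ?_⟩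
  obtain ⟨hdet, hsep⟩ := hgen x hx
  obtain ⟨Q, d, hQ, hd, hA, hB⟩ := exists_simultaneous_congruence (formMatrix e x.1)
    (formMatrix e x.2) (formMatrix_transpose e _) (formMatrix_transpose e _) hdet hsep
  let e' := e.map (Matrix.toLinearEquiv e Q hQ)
  have he' : ∀ k, e' k = ∑ i, Q i k • e i := fun k => Matrix.toLin_self e e Q k
  refine hasAlgType_of_diagonal e' d hd x.1 x.2 ?_
    (coe_eq_sum_of_formMatrix_eq e e' Q d he' x.2 hB)
  simpa using coe_eq_sum_of_formMatrix_eq e e' Q 1 he' x.1 (by simpa using hA)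

end JordanKronecker

theorem theoremT {K : Type*} [Field K] [IsAlgClosed K] [CharZero K]
    {V : Type*} [AddCommGroup V] [Module K V] [FiniteDimensional K V]
    (n : ℕ) (hn : 1 < n) (hV : Module.finrank K V = n) :
    JordanKronecker.HasJKInvariant (JordanKronecker.slSymCongruence K V)
      { jordan := 0
        horizontal := Multiset.replicate (n * (n - 1) / 2) 2
        vertical := {n} } := by
  obtain ⟨m, rfl⟩ : ∃ m, n = m + 1 := ⟨n - 1, by omega⟩
  exact JordanKronecker.hasJKInvariant_slSymCongruence m hV
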